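/- A cell in row $a$ and column $b$ of the Young diagram of a partition $\pi$ is labelled by the least non-negative residue of $b-a$ modulo $t$, and $r_i(\pi,t)$ denotes the number of cells of $\pi$ labelled $i$. The GBG-rank of $\pi$ modulo $t$ is $\mathrm{GBG}^{(t)}(\pi)=\sum_{i=0}^{t-1} r_i(\pi,t)\,\omega_t^{\,i}$, where $\omega_t=e^{2\pi\sqrt{-1}/t}$. Write $l(\pi)$ for the largest part of $\pi$ ($0$ for the empty partition) and $|\pi|$ for the sum of its parts. For $z\in\mathbb{C}$ and an integer $M\ge 0$ let $$G_{M,t}(z,q)=\sum_{\substack{\pi:\ \mathrm{GBG}^{(t)}(\pi)=z,\\ l(\pi)\le M}} q^{|\pi|},$$ a formal power series in $q$, the sum being over all partitions $\pi$, including the empty one. For an integer $L\ge0$ let $(\tilde q)_L=\prod_{m=1}^{L}(1-\tilde q^{\,m})$, and for an integer $L<0$ let $1/(\tilde q)_L=0$. Let $\delta_{a,b}$ be the Kronecker delta. **Theorem 4.1.** Let $t$ be an odd prime, $N\ge0$ an integer, $\nu\in\{0,1,\ldots,t-1\}$, $1\le j\le t-1$, and $k$ any integer. Then, with $\tilde q=q^t$,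 $$G_{tN+\nu,t}(k\omega_t^{\,j},q)=\frac{q^{tk^2+k}}{\displaystyle\prod_{i=0}^{t-1}(\tilde q)_{N+k\delta_{i,j-1}-k\delta_{i,j}+\lceil(\nu-i)/t\rceil}}.$$ -/

import Mathlib

open Finset
open scoped PowerSeries

/-- The `i`-th part (counted from `0`) of a partition in non-increasing order; `0` beyond the last
part. -/
def partAt {n : ℕ} (p : n.Partition) (i : ℕ) : ℕ :=
  (p.parts.sort (· ≥ ·)).getD i 0

/-- The largest part of a partition (`0` for the empty partition). -/
def largestPart {n : ℕ} (p : n.Partition) : ℕ := p.parts.sup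

/-- The cells `⟨i, c⟩` (row `i`, column `c`, both counted from `0`) of the Young diagram. -/
def youngCells {n : ℕ} (p : n.Partition) : Finset (Σ _ : ℕ, ℕ) :=
  (range p.parts.card).sigma fun i => range (partAt p i)

/-- `r_a(π, t)`: the number of cells labelled `a` in the `t`-residue diagram, in which a cell is
labelled by the residue of (column − row) modulo `t`. -/
def residueCount {n : ℕ} (p : n.Partition) (t a : ℕ) : ℕ :=
  #{x ∈ youngCells p | ((x.2 : ℤ) - (x.1 : ℤ)) % (t : ℤ) = (a : ℤ)}

/-- `ω_t = exp (2πi / t)`. -/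
noncomputable def rootOmega (t : ℕ) : ℂ :=
  Complex.exp (2 * (Real.pi : ℂ) * Complex.I / (t : ℂ))

/-- The GBG-rank of a partition modulo `t`, `∑_{a=0}^{t-1} r_a ω_t ^ a`. -/
noncomputable def gbgRank {n : ℕ} (p : n.Partition) (t : ℕ) : ℂ :=
  ∑ a ∈ range t, (residueCount p t a : ℂ) * rootOmega t ^ a

open Classical in
/-- `G_{M,t}(z, q)`: the generating function (a formal power series in `q`) of the partitions with
largest part at most `M` and GBG-rank modulo `t` equal to `z`. -/
noncomputable def gbgGenFun (M t : ℕ) (z : ℂ) : ℚ⟦X⟧ :=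
  PowerSeries.mk fun n =>
    (#{p : n.Partition | gbgRank p t = z ∧ largestPart p ≤ M} : ℚ)

/-- The `q`-Pochhammer symbol `(a; q)_L = ∏_{i=0}^{L-1} (1 - a q^i)`. -/
noncomputable def qPoch (a q : ℚ⟦X⟧) (L : ℕ) : ℚ⟦X⟧ :=
  ∏ i ∈ range L, (1 - a * q ^ i)

/-- `1 / (q; q)_L` for an integer `L`, with the usual convention that it is `0` for `L < 0`.
For `L ≥ 0` and `q` without constant term, `(q; q)_L` has constant term `1`, so that the inverse is
the genuine one. -/
noncomputable def qPochRecip (q : ℚ⟦X⟧) (L : ℤ) : ℚ⟦X⟧ :=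
  if L < 0 then 0 else (qPoch q q L.toNat)⁻¹

/-! A partition with parts at most `M` is encoded by its beta-set `B`, an `M`-element subset of `ℕ`
whose elements sum to the size plus `M.choose 2`. Down column `c` the labels are `c, c - 1, …`, so
the difference of the counts of labels `a` and `a + 1` telescopes, and over all columns it is
governed by the residue class sizes of `B` (`residue_sum_sub`).

For `t` prime, the powers of `ω_t` satisfy no rational relation except proportionality to their
vanishing sum. Hence the rank is `k ω_t ^ j` iff the label counts, less `k` at label `j`, are all
equal, that is, iff `B` has prescribed class sizes (`gbgRank_eq_iff_classSize`): those of the empty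
partition, with `k` added to one class and subtracted from another.

Subsets with prescribed class sizes are chosen independently class by class. A class `r` of size `m`
contributes `q ^ (r m + t (m choose 2)) / (q ^ t; q ^ t)_m` (`coeff_sum_residue_classes`), and the
exponents add up to `t k² + k + M.choose 2` (`sum_weight`). A negative prescribed size makes both
sides vanish. -/

/-! ### Generating functions of finite subsets -/

/-- The generating polynomial `∑ q ^ (∑ B)` over the `m`-element subsets `B` of `{0, …, K - 1}`. -/
def subsetGen {R : Type*} [CommRing R] (q : R) (m K : ℕ) : R :=
  ∑ B ∈ powersetCard m (range K), q ^ (∑ b ∈ B, b)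

theorem subsetGen_zero {R : Type*} [CommRing R] (q : R) (K : ℕ) : subsetGen q 0 K = 1 := by
  simp [subsetGen]

theorem subsetGen_succ_succ {R : Type*} [CommRing R] (q : R) (m K : ℕ) :
    subsetGen q (m + 1) (K + 1) = subsetGen q (m + 1) K + q ^ K * subsetGen q m K := by
  have hK : K ∉ range K := by simp
  have hmem : ∀ B ∈ powersetCard m (range K), K ∉ B := fun B hB h =>
    hK ((mem_powersetCard.1 hB).1 h)
  unfold subsetGen
  rw [range_add_one, powersetCard_succ_insert hK, sum_union, sum_image, mul_sum]
  · congr 1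
    refine sum_congr rfl fun B hB => ?_
    rw [sum_insert (hmem B hB), pow_add]
  · intro A hA B hB h
    have h' := congrArg (fun S => S.erase K) h
    simpa [erase_insert (hmem A hA), erase_insert (hmem B hB)] using h'
  · rw [disjoint_left]
    intro A hA hA'
    obtain ⟨B, -, rfl⟩ := mem_image.1 hA'
    exact hK ((mem_powersetCard.1 hA).1 (mem_insert_self _ _))

/-- The ratio of consecutive Gaussian binomials, kept free of division; it follows from the Pascal
recurrence `subsetGen_succ_succ`. -/
theorem one_sub_pow_mul_subsetGen_succ {R : Type*} [CommRing R] (q : R) (m K : ℕ) :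
    (1 - q ^ (m + 1)) * subsetGen q (m + 1) K = (q ^ m - q ^ K) * subsetGen q m K := by
  induction K generalizing m with
  | zero =>
    have hzero : ∀ m, subsetGen q (m + 1) 0 = 0 := fun m => by
      rw [subsetGen, powersetCard_eq_empty.2 (by simp), sum_empty]
    cases m <;> simp [hzero]
  | succ K ih =>
    rw [subsetGen_succ_succ, mul_add, ih]
    cases m with
    | zero => simp only [subsetGen_zero]; ring
    | succ m =>
      rw [subsetGen_succ_succ]
      linear_combination q ^ (K + 1) * ih m

theorem qPoch_mul_subsetGen (q : ℚ⟦X⟧) (m K : ℕ) :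
    qPoch q q m * subsetGen q m K = ∏ s ∈ range m, (q ^ s - q ^ K) := by
  induction m with
  | zero => simp [qPoch, subsetGen_zero]
  | succ m ih =>
    rw [prod_range_succ, ← ih, qPoch, prod_range_succ, ← qPoch, ← pow_succ']
    linear_combination qPoch q q m * one_sub_pow_mul_subsetGen_succ q m K

theorem constantCoeff_qPoch (q : ℚ⟦X⟧) (hq : PowerSeries.constantCoeff q = 0) (m : ℕ) :
    PowerSeries.constantCoeff (qPoch q q m) = 1 := by
  simp [qPoch, map_prod, hq]

/-- Modulo `q ^ K` each factor `q ^ s - q ^ K` becomes `q ^ s`, so the bounded count agrees with the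
unbounded one to this order. -/
theorem pow_dvd_subsetGen_sub (q : ℚ⟦X⟧) (hq : PowerSeries.constantCoeff q = 0) (m K : ℕ) :
    q ^ K ∣ subsetGen q m K - q ^ (m.choose 2) * (qPoch q q m)⁻¹ := by
  have hu : qPoch q q m * (qPoch q q m)⁻¹ = 1 :=
    PowerSeries.mul_inv_cancel _ (by rw [constantCoeff_qPoch q hq]; exact one_ne_zero)
  have hE : subsetGen q m K = (∏ s ∈ range m, (q ^ s - q ^ K)) * (qPoch q q m)⁻¹ := by
    rw [← qPoch_mul_subsetGen]; linear_combination (-subsetGen q m K) * hu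
  have hp : q ^ K ∣ (∏ s ∈ range m, (q ^ s - q ^ K)) - ∏ s ∈ range m, q ^ s := by
    rw [← Ideal.mem_span_singleton, ← Ideal.Quotient.eq, map_prod, map_prod]
    refine prod_congr rfl fun s _ => ?_
    rw [Ideal.Quotient.eq, Ideal.mem_span_singleton]
    exact ⟨-1, by ring⟩
  rw [prod_pow_eq_pow_sum, sum_range_id, ← Nat.choose_two_right] at hp
  rw [hE, ← sub_mul]
  exact hp.mul_right _

/-- Splitting a subset of `{0, …, tK - 1}` into its residue classes modulo `t`. -/
theorem sum_pow_residue_classes {R : Type*} [CommRing R] (q : R) (t K : ℕ) (m : Fin t → ℕ) :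
    ∑ B ∈ (range (t * K)).powerset with ∀ r : Fin t, #{b ∈ B | b % t = r} = m r,
        q ^ (∑ b ∈ B, b) =
      ∏ r : Fin t, q ^ ((r : ℕ) * m r) * subsetGen (q ^ t) (m r) K := by
  have hcls : ∀ (B : Finset ℕ), B ⊆ range (t * K) → ∀ r : Fin t,
      {b ∈ B | b % t = r} = {b ∈ range K | (r : ℕ) + t * b ∈ B}.image fun b => (r : ℕ) + t * b := by
    intro B hB r
    ext x
    simp only [mem_filter, mem_image, mem_range]
    constructor
    · rintro ⟨hx, hr⟩
      have := Nat.mod_add_div x t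
      rw [hr] at this
      exact ⟨x / t, ⟨Nat.div_lt_of_lt_mul (mem_range.1 (hB hx)), by rwa [this]⟩, this⟩
    · rintro ⟨b, ⟨-, hb⟩, rfl⟩
      exact ⟨hb, by rw [Nat.add_mul_mod_self_left, Nat.mod_eq_of_lt r.2]⟩
  have hinj : ∀ r : Fin t, Function.Injective fun b : ℕ => (r : ℕ) + t * b := by
    intro r a b h
    exact Nat.eq_of_mul_eq_mul_left (Nat.zero_lt_of_lt r.2) (Nat.add_left_cancel h)
  have hterm : ∀ r : Fin t, q ^ ((r : ℕ) * m r) * subsetGen (q ^ t) (m r) K =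
      ∑ S ∈ powersetCard (m r) (range K), q ^ (∑ b ∈ S, ((r : ℕ) + t * b)) := by
    intro r
    rw [subsetGen, mul_sum]
    refine sum_congr rfl fun S hS => ?_
    rw [sum_add_distrib, sum_const, (mem_powersetCard.1 hS).2, ← mul_sum, pow_add, pow_mul q t,
      smul_eq_mul, mul_comm (m r)]
  have hglue : ∀ (S : Fin t → Finset ℕ) (r : Fin t) (b : ℕ),
      (r : ℕ) + t * b ∈ univ.biUnion (fun r : Fin t => (S r).image fun b => (r : ℕ) + t * b) ↔
        b ∈ S r := by
    intro S r b
    simp only [mem_biUnion, mem_univ, true_and, mem_image]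
    constructor
    · rintro ⟨r', b', hb', h⟩
      have hr : r' = r := by
        have := congrArg (· % t) h
        simp only [Nat.add_mul_mod_self_left, Nat.mod_eq_of_lt r.2, Nat.mod_eq_of_lt r'.2] at this
        exact Fin.ext this
      subst hr
      rwa [← hinj _ h]
    · intro hb
      exact ⟨r, b, hb, rfl⟩
  simp_rw [hterm]
  rw [prod_univ_sum]
  refine sum_bij' (fun B _ r => {b ∈ range K | (r : ℕ) + t * b ∈ B})
    (fun S _ => univ.biUnion fun r : Fin t => (S r).image fun b => (r : ℕ) + t * b) ?_ ?_ ?_ ?_ ?_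
  · intro B hB
    rw [mem_filter, mem_powerset] at hB
    rw [Fintype.mem_piFinset]
    intro r
    rw [mem_powersetCard]
    refine ⟨filter_subset _ _, ?_⟩
    rw [← hB.2 r, hcls B hB.1, card_image_of_injective _ (hinj r)]
  · intro S hS
    rw [Fintype.mem_piFinset] at hS
    have hsub : (univ.biUnion fun r : Fin t => (S r).image fun b => (r : ℕ) + t * b) ⊆
        range (t * K) := by
      intro x hx
      simp only [mem_biUnion, mem_univ, true_and, mem_image] at hx
      obtain ⟨r, b, hb, rfl⟩ := hx
      have hbK := mem_range.1 ((mem_powersetCard.1 (hS r)).1 hb)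
      have := r.2
      rw [mem_range]
      nlinarith
    rw [mem_filter, mem_powerset]
    refine ⟨hsub, fun r => ?_⟩
    rw [hcls _ hsub, card_image_of_injective _ (hinj r), ← (mem_powersetCard.1 (hS r)).2]
    congr 1
    ext b
    rw [mem_filter, hglue]
    exact ⟨fun h => h.2, fun h => ⟨(mem_powersetCard.1 (hS r)).1 h, h⟩⟩
  · intro B hB
    rw [mem_filter, mem_powerset] at hB
    ext x
    simp only [← hcls B hB.1, mem_biUnion, mem_univ, true_and, mem_filter]
    constructor
    · rintro ⟨r, hx, -⟩
      exact hx
    · intro hx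
      have ht : 0 < t := by
        rcases Nat.eq_zero_or_pos t with rfl | h
        · simpa using hB.1 hx
        · exact h
      exact ⟨⟨x % t, Nat.mod_lt _ ht⟩, hx, rfl⟩
  · intro S hS
    rw [Fintype.mem_piFinset] at hS
    funext r
    ext b
    rw [mem_filter, hglue]
    exact ⟨fun h => h.2, fun h => ⟨(mem_powersetCard.1 (hS r)).1 h, h⟩⟩
  · intro B hB
    rw [mem_filter, mem_powerset] at hB
    rw [prod_pow_eq_pow_sum]
    congr 1
    have : ∀ r : Fin t, ∑ b ∈ range K with (r : ℕ) + t * b ∈ B, ((r : ℕ) + t * b) =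
        ∑ x ∈ B with x % t = r, x := by
      intro r
      rw [hcls B hB.1, sum_image fun a _ b _ h => hinj r h]
    simp_rw [this]
    rw [Fin.sum_univ_eq_sum_range (fun r => ∑ x ∈ B with x % t = r, x) t]
    refine (sum_fiberwise_of_maps_to (fun x hx => ?_) _).symm
    rcases Nat.eq_zero_or_pos t with rfl | h
    · simpa using hB.1 hx
    · exact mem_range.2 (Nat.mod_lt _ h)

/-! ### Partitions through their column lengths -/

/-- The length of column `c` (counted from `0`) of the Young diagram. -/
def colLength {n : ℕ} (p : n.Partition) (c : ℕ) : ℕ := p.parts.countP (c < ·)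

theorem countP_lt_eq_add_count (s : Multiset ℕ) (c : ℕ) :
    s.countP (c < ·) = s.countP (c + 1 < ·) + s.count (c + 1) := by
  induction s using Multiset.induction_on with
  | empty => simp
  | cons a s ih =>
    rw [Multiset.countP_cons, Multiset.countP_cons, Multiset.count_cons, ih]
    split_ifs <;> omega

theorem sum_eq_sum_countP_lt (s : Multiset ℕ) (M : ℕ) (hs : ∀ a ∈ s, a ≤ M) :
    s.sum = ∑ c ∈ range M, s.countP (c < ·) := by
  induction s using Multiset.induction_on with
  | empty => simp
  | cons a s ih =>
    have ha : ∑ c ∈ range M, (if c < a then 1 else 0) = a := by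
      have : {c ∈ range M | c < a} = range a := by
        ext c
        have := hs a (Multiset.mem_cons_self a s)
        simp only [mem_filter, mem_range]
        omega
      rw [sum_boole, this, card_range, Nat.cast_id]
    simp_rw [Multiset.countP_cons]
    rw [sum_add_distrib, ha, ← ih fun b hb => hs b (Multiset.mem_cons_of_mem hb),
      Multiset.sum_cons, add_comm]

theorem largestPart_le_iff {n : ℕ} (p : n.Partition) (M : ℕ) :
    largestPart p ≤ M ↔ ∀ a ∈ p.parts, a ≤ M := Multiset.sup_le

theorem colLength_anti {n : ℕ} (p : n.Partition) : Antitone (colLength p) :=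
  antitone_nat_of_succ_le fun c => by
    unfold colLength
    rw [countP_lt_eq_add_count p.parts c]
    exact Nat.le_add_right _ _

theorem colLength_eq_zero {n : ℕ} {p : n.Partition} {M c : ℕ} (hp : largestPart p ≤ M)
    (hc : M ≤ c) : colLength p c = 0 := by
  rw [colLength, Multiset.countP_eq_zero]
  intro a ha
  have := (largestPart_le_iff p M).1 hp a ha
  omega

theorem sum_colLength {n : ℕ} {p : n.Partition} {M : ℕ} (hp : largestPart p ≤ M) :
    ∑ c ∈ range M, colLength p c = n := by
  unfold colLength
  rw [← sum_eq_sum_countP_lt _ _ ((largestPart_le_iff p M).1 hp), p.parts_sum]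

theorem partition_ext_of_colLength {n : ℕ} {p p' : n.Partition}
    (h : ∀ c, colLength p c = colLength p' c) : p = p' := by
  ext1
  ext a
  rcases a with _ | a
  · rw [Multiset.count_eq_zero_of_notMem fun h0 => (p.parts_pos h0).ne rfl,
      Multiset.count_eq_zero_of_notMem fun h0 => (p'.parts_pos h0).ne rfl]
  · have h1 := countP_lt_eq_add_count p.parts a
    have h2 := countP_lt_eq_add_count p'.parts a
    have h3 := h a
    have h4 := h (a + 1)
    unfold colLength at h3 h4
    omega

/-- The multiset of parts with prescribed column lengths `h 0 ≥ h 1 ≥ ⋯ ≥ h M = 0`. -/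
theorem exists_partition_colLength {n M : ℕ} (h : ℕ → ℕ) (hanti : Antitone h) (hM : h M = 0)
    (hsum : ∑ c ∈ range M, h c = n) :
    ∃ p : n.Partition, largestPart p ≤ M ∧ ∀ c ≤ M, colLength p c = h c := by
  set s : Multiset ℕ := ∑ a ∈ range M, Multiset.replicate (h a - h (a + 1)) (a + 1) with hs
  have hmem : ∀ a ∈ s, 0 < a ∧ a ≤ M := by
    intro a ha
    rw [hs, Multiset.mem_sum] at ha
    obtain ⟨b, hb, hab⟩ := ha
    have := Multiset.eq_of_mem_replicate hab
    have := mem_range.1 hb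
    omega
  have hcount : ∀ c < M, s.count (c + 1) = h c - h (c + 1) := by
    intro c hc
    rw [hs, Multiset.count_sum', sum_eq_single_of_mem c (mem_range.2 hc)]
    · simp
    · intro b _ hbc
      rw [Multiset.count_replicate, if_neg (by omega)]
  -- Induction runs leftwards from column `M`, where both sides are `0`.
  have hcol : ∀ d ≤ M, s.countP (M - d < ·) = h (M - d) := by
    intro d
    induction d with
    | zero =>
      intro _
      rw [Nat.sub_zero, hM, Multiset.countP_eq_zero]
      intro a ha
      exact not_lt.2 (hmem a ha).2
    | succ d ih =>
      intro hd
      have e : M - (d + 1) + 1 = M - d := by omega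
      rw [countP_lt_eq_add_count, hcount _ (by omega), e, ih (by omega)]
      have := hanti (show M - (d + 1) ≤ M - d by omega)
      omega
  have hcol' : ∀ c ≤ M, s.countP (c < ·) = h c := by
    intro c hc
    have := hcol (M - c) (by omega)
    rwa [Nat.sub_sub_self hc] at this
  refine ⟨⟨s, fun ha => (hmem _ ha).1, ?_⟩, ?_, hcol'⟩
  · rw [sum_eq_sum_countP_lt s M fun a ha => (hmem a ha).2, ← hsum]
    exact sum_congr rfl fun c hc => hcol' c (mem_range.1 hc).le
  · rw [largestPart_le_iff]
    exact fun a ha => (hmem a ha).2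

/-! ### Beta-sets -/

/-- The first-column hook lengths of the conjugate partition, padded to `M` elements. -/
def betaSet {n : ℕ} (p : n.Partition) (M : ℕ) : Finset ℕ :=
  (range M).image fun c => colLength p c + (M - 1 - c)

theorem injOn_beta {n : ℕ} (p : n.Partition) (M : ℕ) :
    Set.InjOn (fun c => colLength p c + (M - 1 - c)) (range M) := by
  intro a ha b hb hab
  rw [mem_coe, mem_range] at ha hb
  simp only at hab
  rcases lt_trichotomy a b with h | h | h
  · have := colLength_anti p h.le
    omega
  · exact h
  · have := colLength_anti p h.le
    omega

theorem card_betaSet {n : ℕ} (p : n.Partition) (M : ℕ) : (betaSet p M).card = M := by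
  rw [betaSet, card_image_of_injOn (injOn_beta p M), card_range]

theorem sum_betaSet {n : ℕ} {p : n.Partition} {M : ℕ} (hp : largestPart p ≤ M) :
    ∑ b ∈ betaSet p M, b = n + M.choose 2 := by
  rw [betaSet, sum_image (injOn_beta p M), sum_add_distrib, sum_colLength hp,
    sum_range_reflect (fun c => c), sum_range_id, Nat.choose_two_right]

/-- Reading the columns from right to left lists the beta-set increasingly, and a strictly
increasing function on `Fin M` is determined by its range. -/
theorem betaSet_inj {n M : ℕ} {p p' : n.Partition} (hp : largestPart p ≤ M)
    (hp' : largestPart p' ≤ M) (h : betaSet p M = betaSet p' M) : p = p' := by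
  have hmono : ∀ p : n.Partition,
      StrictMono fun d : Fin M => colLength p (M - 1 - d) + (d : ℕ) := by
    intro p a b hab
    have := colLength_anti p (show M - 1 - (b : ℕ) ≤ M - 1 - a by omega)
    have : (a : ℕ) < b := hab
    simp only
    omega
  have hrange : ∀ p : n.Partition,
      Set.range (fun d : Fin M => colLength p (M - 1 - d) + (d : ℕ)) = betaSet p M := by
    intro p
    ext x
    simp only [Set.mem_range, betaSet, coe_image, Set.mem_image, mem_coe, mem_range]
    constructor
    · rintro ⟨d, rfl⟩
      refine ⟨M - 1 - d, by omega, ?_⟩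
      congr 1
      omega
    · rintro ⟨c, hc, rfl⟩
      refine ⟨⟨M - 1 - c, by omega⟩, ?_⟩
      have : M - 1 - (M - 1 - c) = c := by omega
      simp only [this]
  have heq := ((hmono p).range_inj (hmono p')).1 (by rw [hrange, hrange, h])
  refine partition_ext_of_colLength fun c => ?_
  rcases lt_or_ge c M with hc | hc
  · have := congrFun heq ⟨M - 1 - c, by omega⟩
    have e : M - 1 - (M - 1 - c) = c := by omega
    simp only [e] at this
    omega
  · rw [colLength_eq_zero hp hc, colLength_eq_zero hp' hc]

theorem exists_strictMonoOn_image_eq (B : Finset ℕ) :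
    ∃ f : ℕ → ℕ, StrictMonoOn f (range B.card) ∧ (range B.card).image f = B := by
  refine ⟨fun d => if hd : d < B.card then B.orderEmbOfFin rfl ⟨d, hd⟩ else 0, ?_, ?_⟩
  · intro a ha b hb hab
    rw [mem_coe, mem_range] at ha hb
    simp only [dif_pos ha, dif_pos hb]
    exact (B.orderEmbOfFin rfl).strictMono hab
  · ext x
    rw [mem_image]
    constructor
    · rintro ⟨d, hd, rfl⟩
      rw [dif_pos (mem_range.1 hd)]
      exact orderEmbOfFin_mem _ _ _
    · intro hx
      rw [← mem_coe, ← range_orderEmbOfFin B rfl] at hx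
      obtain ⟨d, rfl⟩ := hx
      exact ⟨d, mem_range.2 d.2, dif_pos d.2⟩

theorem exists_betaSet_eq {n M : ℕ} (B : Finset ℕ) (hB : B.card = M)
    (hsum : ∑ b ∈ B, b = n + M.choose 2) :
    ∃ p : n.Partition, largestPart p ≤ M ∧ betaSet p M = B := by
  obtain ⟨f, hf, himg⟩ := exists_strictMonoOn_image_eq B
  rw [hB] at hf himg
  have hlt : ∀ d, d + 1 < M → f d < f (d + 1) := fun d hd =>
    hf (mem_range.2 (by omega)) (mem_range.2 hd) (Nat.lt_succ_self d)
  -- This makes the truncated subtraction in `h` below genuine.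
  have hge : ∀ d, d < M → d ≤ f d := by
    intro d
    induction d with
    | zero => intro _; exact Nat.zero_le _
    | succ d ih =>
      intro hd
      have := ih (by omega)
      have := hlt d hd
      omega
  set h : ℕ → ℕ := fun c => if c < M then f (M - 1 - c) - (M - 1 - c) else 0 with hh
  have hbeta : ∀ c ∈ range M, h c + (M - 1 - c) = f (M - 1 - c) := by
    intro c hc
    rw [mem_range] at hc
    have := hge (M - 1 - c) (by omega)
    simp only [hh, if_pos hc]
    omega
  have hanti : Antitone h := by
    refine antitone_nat_of_succ_le fun c => ?_
    simp only [hh]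
    split_ifs with h1 h2
    · have := hlt (M - 1 - (c + 1)) (by omega)
      rw [show M - 1 - (c + 1) + 1 = M - 1 - c by omega] at this
      omega
    · omega
    · exact Nat.zero_le _
    · exact le_rfl
  have himg' : (range M).image (fun c => h c + (M - 1 - c)) = B := by
    rw [← himg]
    ext x
    simp only [mem_image]
    constructor
    · rintro ⟨c, hc, rfl⟩
      exact ⟨M - 1 - c, mem_range.2 (by have := mem_range.1 hc; omega), (hbeta c hc).symm⟩
    · rintro ⟨d, hd, rfl⟩
      rw [mem_range] at hd
      refine ⟨M - 1 - d, mem_range.2 (by omega), ?_⟩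
      rw [hbeta _ (mem_range.2 (by omega)), show M - 1 - (M - 1 - d) = d by omega]
  have hinj : Set.InjOn (fun c => h c + (M - 1 - c)) (range M) := by
    rw [← card_image_iff, himg', hB, card_range]
  have hsum' : ∑ c ∈ range M, h c = n := by
    rw [← himg', sum_image hinj, sum_add_distrib, sum_range_reflect (fun c => c), sum_range_id,
      ← Nat.choose_two_right] at hsum
    exact Nat.add_right_cancel hsum
  obtain ⟨p, hp, hcol⟩ := exists_partition_colLength h hanti (by simp [hh]) hsum'
  refine ⟨p, hp, ?_⟩
  rw [← himg', betaSet]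
  exact image_congr fun c hc => by simp only [hcol c (mem_range.1 hc).le]

/-- The bound `W` only makes the family of subsets finite: no element of `B` exceeds the sum of `B`.
-/
theorem card_partition_eq_card_finset (n M W : ℕ) (hW : n + M.choose 2 < W)
    (Q : Finset ℕ → Prop) [DecidablePred Q]
    [DecidablePred fun p : n.Partition => Q (betaSet p M) ∧ largestPart p ≤ M] :
    #{p : n.Partition | Q (betaSet p M) ∧ largestPart p ≤ M} =
      #{B ∈ (range W).powerset | (B.card = M ∧ Q B) ∧ ∑ b ∈ B, b = n + M.choose 2} := by
  refine card_bij (fun p _ => betaSet p M) ?_ ?_ ?_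
  · intro p hp
    rw [mem_filter] at hp
    rw [mem_filter, mem_powerset]
    refine ⟨fun b hb => ?_, ⟨card_betaSet p M, hp.2.1⟩, sum_betaSet hp.2.2⟩
    have := single_le_sum (f := fun b : ℕ => b) (fun _ _ => Nat.zero_le _) hb
    rw [sum_betaSet hp.2.2] at this
    exact mem_range.2 (this.trans_lt hW)
  · intro p hp p' hp' h
    exact betaSet_inj (mem_filter.1 hp).2.2 (mem_filter.1 hp').2.2 h
  · intro B hB
    rw [mem_filter] at hB
    obtain ⟨p, hp, rfl⟩ := exists_betaSet_eq B hB.2.1.1 hB.2.2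
    exact ⟨p, mem_filter.2 ⟨mem_univ _, hB.2.1.2, hp⟩, rfl⟩

/-! ### Residue counts column by column -/

theorem lt_getD_iff_lt_countP (l : List ℕ) (hl : l.Pairwise (· ≥ ·)) (c i : ℕ) :
    c < l.getD i 0 ↔ i < l.countP (c < ·) := by
  induction l generalizing i with
  | nil => simp
  | cons a l ih =>
    rw [List.pairwise_cons] at hl
    by_cases hca : c < a
    · cases i with
      | zero => simp [hca]
      | succ i => simp only [List.getD_cons_succ, List.countP_cons, ih hl.2]; simp [hca]
    · have hzero : l.countP (c < ·) = 0 := by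
        rw [List.countP_eq_zero]
        intro b hb
        have := hl.1 b hb
        simp only [decide_eq_true_eq]
        omega
      cases i with
      | zero => simp only [List.getD_cons_zero, List.countP_cons, hzero]; simp [hca]
      | succ i =>
        simp only [List.getD_cons_succ, List.countP_cons, ih hl.2, hzero]; simp [hca]

theorem lt_partAt_iff {n : ℕ} (p : n.Partition) (c i : ℕ) :
    c < partAt p i ↔ i < colLength p c := by
  rw [partAt, lt_getD_iff_lt_countP _ (p.parts.pairwise_sort (· ≥ ·)), colLength]
  conv_rhs => rw [← p.parts.sort_eq (· ≥ ·), Multiset.coe_countP]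

theorem residueCount_eq_sum {n M t : ℕ} {p : n.Partition} (hp : largestPart p ≤ M) {a : ℕ}
    (ha : a < t) :
    (residueCount p t a : ℤ) = ∑ c ∈ range M, ∑ i ∈ range (colLength p c),
      if (c : ZMod t) - (i : ZMod t) = (a : ZMod t) then 1 else 0 := by
  have hiff : ∀ x y : ℕ, ((x : ℤ) - (y : ℤ)) % (t : ℤ) = (a : ℤ) ↔
      (x : ZMod t) - (y : ZMod t) = (a : ZMod t) := by
    intro x y
    have h := ZMod.intCast_eq_intCast_iff' ((x : ℤ) - y) a t
    rw [Int.emod_eq_of_lt (Int.natCast_nonneg a) (Int.ofNat_lt.2 ha)] at h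
    push_cast at h
    exact h.symm
  simp_rw [sum_boole]
  rw [← Nat.cast_sum, Nat.cast_inj, ← card_sigma, residueCount]
  refine card_bij' (fun x _ => ⟨x.2, x.1⟩) (fun x _ => ⟨x.2, x.1⟩) ?_ ?_ (fun _ _ => rfl)
    (fun _ _ => rfl)
  · rintro ⟨i, c⟩ h
    simp only [youngCells, mem_filter, mem_sigma, mem_range, lt_partAt_iff, hiff] at h ⊢
    refine ⟨?_, h.1.2, h.2⟩
    by_contra hc
    have := colLength_eq_zero hp (not_lt.1 hc)
    omega
  · rintro ⟨c, i⟩ h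
    simp only [youngCells, mem_filter, mem_sigma, mem_range, lt_partAt_iff, hiff] at h ⊢
    exact ⟨⟨h.2.1.trans_le (Multiset.countP_le_card _ _), h.2.1⟩, h.2.2⟩

/-- Differences of consecutive residue counts are read off from the beta-set. -/
theorem residue_sum_sub {n : ℕ} (p : n.Partition) (M t : ℕ) (a : ZMod t) :
    (∑ c ∈ range M, ∑ i ∈ range (colLength p c),
        if (c : ZMod t) - (i : ZMod t) = a then (1 : ℤ) else 0) -
      (∑ c ∈ range M, ∑ i ∈ range (colLength p c),
        if (c : ZMod t) - (i : ZMod t) = a + 1 then (1 : ℤ) else 0) =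
      #{c ∈ range M | ((c : ℕ) : ZMod t) = a} -
        #{b ∈ betaSet p M | (M : ZMod t) - 1 - ((b : ℕ) : ZMod t) = a} := by
  have hcard : (#{b ∈ betaSet p M | (M : ZMod t) - 1 - ((b : ℕ) : ZMod t) = a} : ℤ) =
      ∑ c ∈ range M, if (c : ZMod t) - (colLength p c : ZMod t) = a then (1 : ℤ) else 0 := by
    rw [natCast_card_filter, betaSet, sum_image (injOn_beta p M)]
    refine sum_congr rfl fun c hc => ?_
    rw [mem_range] at hc
    have : (M : ZMod t) = (M - 1 - c : ℕ) + 1 + c := by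
      have h : M = (M - 1 - c) + 1 + c := by omega
      exact_mod_cast congrArg (Nat.cast (R := ZMod t)) h
    congr 1
    rw [this]
    push_cast
    ring_nf
  rw [hcard, natCast_card_filter, ← sum_sub_distrib, ← sum_sub_distrib]
  refine sum_congr rfl fun c _ => ?_
  rw [← sum_sub_distrib]
  have := sum_range_sub' (fun i : ℕ => if (c : ZMod t) - (i : ZMod t) = a then (1 : ℤ) else 0)
    (colLength p c)
  rw [Nat.cast_zero, sub_zero] at this
  rw [← this]
  refine sum_congr rfl fun i _ => ?_
  congr 2
  rw [Nat.cast_succ, ← sub_sub, sub_eq_iff_eq_add (b := (1 : ZMod t))]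

/-! ### Roots of unity and the GBG-rank -/

theorem isPrimitiveRoot_rootOmega {t : ℕ} (ht : t ≠ 0) : IsPrimitiveRoot (rootOmega t) t :=
  Complex.isPrimitiveRoot_exp t ht

/-- For a prime `t`, the only rational relation between the powers of a primitive `t`-th root of
unity is the vanishing of their sum. -/
theorem sum_mul_pow_eq_zero_iff {t : ℕ} (ht : t.Prime) (c : ℕ → ℤ) :
    ∑ a ∈ range t, (c a : ℂ) * rootOmega t ^ a = 0 ↔ ∀ a < t, c a = c 0 := by
  have hprim := isPrimitiveRoot_rootOmega ht.ne_zero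
  have : Fact t.Prime := ⟨ht⟩
  constructor
  · intro h
    set P : Polynomial ℚ := ∑ a ∈ range t, Polynomial.C (c a : ℚ) * Polynomial.X ^ a with hP
    have hcoeff : ∀ a < t, P.coeff a = c a := by
      intro a ha
      simp [hP, Polynomial.coeff_X_pow, ha]
    have hroot : Polynomial.aeval (rootOmega t) P = 0 := by
      rw [← h, hP, map_sum]
      simp
    have hdvd := minpoly.dvd ℚ _ hroot
    rw [← Polynomial.cyclotomic_eq_minpoly_rat hprim ht.pos] at hdvd
    obtain ⟨Q, hQ⟩ := hdvd
    have hdeg : P.natDegree ≤ t - 1 := by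
      refine Polynomial.natDegree_sum_le_of_forall_le _ _ fun a ha => ?_
      refine (Polynomial.natDegree_C_mul_X_pow_le _ _).trans ?_
      have := mem_range.1 ha
      omega
    -- The cyclotomic polynomial already has degree `t - 1`, so `P` is a constant multiple of `1 + X
    -- + ⋯ + X ^ (t - 1)`.
    have hQdeg : Q.natDegree = 0 := by
      by_cases hQ0 : Q = 0
      · simp [hQ0]
      · rw [hQ, Polynomial.natDegree_mul (Polynomial.cyclotomic_ne_zero t ℚ) hQ0,
          Polynomial.natDegree_cyclotomic, Nat.totient_prime ht] at hdeg
        omega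
    rw [Polynomial.eq_C_of_natDegree_eq_zero hQdeg, Polynomial.cyclotomic_prime] at hQ
    have hconst : ∀ a < t, P.coeff a = Q.coeff 0 := by
      intro a ha
      rw [hQ, Polynomial.coeff_mul_C, Polynomial.finsetSum_coeff]
      simp [Polynomial.coeff_X_pow, ha]
    intro a ha
    have := (hcoeff a ha).symm.trans ((hconst a ha).trans
      ((hconst 0 ht.pos).symm.trans (hcoeff 0 ht.pos)))
    exact_mod_cast this
  · intro h
    have : ∀ a ∈ range t, (c a : ℂ) * rootOmega t ^ a = c 0 * rootOmega t ^ a := fun a ha => by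
      rw [h a (mem_range.1 ha)]
    rw [sum_congr rfl this, ← mul_sum, hprim.geom_sum_eq_zero ht.one_lt, mul_zero]

/-- Since `1` generates `ZMod t`, being constant amounts to invariance under the shift by `1`; this
lets the telescoped differences enter. -/
theorem forall_lt_eq_zero_iff_forall_eq_add_one {t : ℕ} [NeZero t] (g : ZMod t → ℤ) :
    (∀ a < t, g (a : ℕ) = g (0 : ℕ)) ↔ ∀ a : ZMod t, g a = g (a + 1) := by
  constructor
  · intro h
    have hall : ∀ a : ZMod t, g a = g (0 : ℕ) := fun a => by
      rw [← h a.val (ZMod.val_lt a), ZMod.natCast_zmod_val]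
    exact fun a => (hall a).trans (hall _).symm
  · intro h a _
    induction a with
    | zero => rfl
    | succ a ih => rw [Nat.cast_succ, ← h, ih (by omega)]

theorem gbgRank_eq_iff {n M t : ℕ} (ht : t.Prime) {p : n.Partition} (hp : largestPart p ≤ M)
    {j : ℕ} (hj : j < t) (k : ℤ) :
    gbgRank p t = (k : ℂ) * rootOmega t ^ j ↔
      ∀ a : ZMod t, (#{b ∈ betaSet p M | (M : ZMod t) - 1 - ((b : ℕ) : ZMod t) = a} : ℤ) =
        #{c ∈ range M | ((c : ℕ) : ZMod t) = a} + k * (if a + 1 = j then 1 else 0)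
          - k * (if a = j then 1 else 0) := by
  have : NeZero t := ⟨ht.ne_zero⟩
  set g : ZMod t → ℤ := fun a => (∑ c ∈ range M, ∑ i ∈ range (colLength p c),
        if (c : ZMod t) - (i : ZMod t) = a then (1 : ℤ) else 0) - k * (if a = j then 1 else 0)
    with hg
  have hga : ∀ a < t, g (a : ℕ) = residueCount p t a - k * (if a = j then 1 else 0) := by
    intro a ha
    rw [residueCount_eq_sum hp ha]
    have : ((a : ZMod t) = (j : ZMod t)) ↔ a = j := by
      rw [ZMod.natCast_eq_natCast_iff', Nat.mod_eq_of_lt ha, Nat.mod_eq_of_lt hj]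
    simp only [hg, this]
  have hsum : gbgRank p t - (k : ℂ) * rootOmega t ^ j =
      ∑ a ∈ range t, ((g ((a : ℕ) : ZMod t) : ℤ) : ℂ) * rootOmega t ^ a := by
    have : (k : ℂ) * rootOmega t ^ j =
        ∑ a ∈ range t, ((k * (if a = j then 1 else 0) : ℤ) : ℂ) * rootOmega t ^ a := by
      rw [sum_eq_single_of_mem j (mem_range.2 hj)]
      · simp
      · intro a _ haj
        simp [haj]
    rw [this, gbgRank, ← sum_sub_distrib]
    refine sum_congr rfl fun a ha => ?_
    rw [hga a (mem_range.1 ha), ← sub_mul]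
    push_cast
    rfl
  rw [← sub_eq_zero, hsum, sum_mul_pow_eq_zero_iff ht (fun a => g ((a : ℕ) : ZMod t)),
    forall_lt_eq_zero_iff_forall_eq_add_one g]
  refine forall_congr' fun a => ?_
  have := residue_sum_sub p M t a
  simp only [hg]
  constructor <;> intro h <;> linarith

/-! ### Prescribed class sizes for `M = t N + ν` -/

theorem ceil_sub_div_eq {t ν i : ℕ} (hν : ν < t) (hi : i < t) :
    ⌈((ν : ℚ) - (i : ℚ)) / (t : ℚ)⌉ = if i < ν then 1 else 0 := by
  have ht : (0 : ℚ) < t := by exact_mod_cast (Nat.zero_lt_of_lt hν)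
  have h1 : (ν : ℚ) < t := by exact_mod_cast hν
  have h2 : (i : ℚ) < t := by exact_mod_cast hi
  have h3 : (0 : ℚ) ≤ i := Nat.cast_nonneg i
  have h4 : (0 : ℚ) ≤ ν := Nat.cast_nonneg ν
  split_ifs with h
  · have h5 : (i : ℚ) < ν := by exact_mod_cast h
    rw [Int.ceil_eq_iff, lt_div_iff₀ ht, div_le_iff₀ ht]
    push_cast
    constructor <;> linarith
  · have h5 : (ν : ℚ) ≤ i := by exact_mod_cast not_lt.1 h
    rw [Int.ceil_eq_iff, lt_div_iff₀ ht, div_le_iff₀ ht]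
    push_cast
    constructor <;> linarith

theorem card_range_filter_cast_eq {t N ν i : ℕ} (hν : ν < t) (hi : i < t) :
    #{c ∈ range (t * N + ν) | ((c : ℕ) : ZMod t) = (i : ZMod t)} = N + if i < ν then 1 else 0 := by
  have ht := Nat.zero_lt_of_lt hν
  have h := Nat.count_modEq_card (t * N + ν) ht i
  rw [Nat.count_eq_card_filter_range, Nat.mul_add_mod, Nat.mod_eq_of_lt hν, Nat.mod_eq_of_lt hi,
    Nat.mul_add_div ht, Nat.div_eq_of_lt hν, add_zero] at h
  rw [← h]
  simp_rw [ZMod.natCast_eq_natCast_iff]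

/-- The residue modulo `t` of `M - 1 - i`, where `M ≡ ν` modulo `t`. -/
def reflectResidue (t ν i : ℕ) : ℕ := if i < ν then ν - 1 - i else t + ν - 1 - i

theorem reflectResidue_lt {t ν i : ℕ} (hν : ν < t) (hi : i < t) : reflectResidue t ν i < t := by
  unfold reflectResidue
  split_ifs <;> omega

/-- The reflection of residues as a permutation of `Fin t`. -/
def reflectPerm {t ν : ℕ} (hν : ν < t) : Equiv.Perm (Fin t) :=
  Function.Involutive.toPerm
    (fun i : Fin t => (⟨reflectResidue t ν i, reflectResidue_lt hν i.2⟩ : Fin t)) (by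
      intro i
      have := i.2
      apply Fin.ext
      simp only [reflectResidue]
      split_ifs <;> omega)

theorem reflectPerm_reflectPerm {t ν : ℕ} (hν : ν < t) (i : Fin t) :
    reflectPerm hν (reflectPerm hν i) = i := (reflectPerm hν).symm_apply_apply i

theorem coe_reflectPerm {t ν : ℕ} (hν : ν < t) (i : Fin t) :
    (reflectPerm hν i : ℕ) = reflectResidue t ν i := rfl

theorem reflect_cast_eq_iff {t N ν i : ℕ} (hν : ν < t) (hi : i < t) (b : ℕ) :
    ((t * N + ν : ℕ) : ZMod t) - 1 - (b : ZMod t) = (i : ZMod t) ↔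
      b % t = reflectResidue t ν i := by
  have hcast : (reflectResidue t ν i : ZMod t) = (ν : ZMod t) - 1 - i := by
    unfold reflectResidue
    split_ifs with h
    · have : ν = (ν - 1 - i) + 1 + i := by omega
      have := congrArg (Nat.cast (R := ZMod t)) this
      push_cast at this
      linear_combination -this
    · have : t + ν = (t + ν - 1 - i) + 1 + i := by omega
      have := congrArg (Nat.cast (R := ZMod t)) this
      push_cast at this
      rw [ZMod.natCast_self] at this
      linear_combination -this
  have h2 := ZMod.natCast_eq_natCast_iff' b (reflectResidue t ν i) t
  rw [Nat.mod_eq_of_lt (reflectResidue_lt hν hi), hcast] at h2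
  rw [← h2]
  push_cast
  rw [ZMod.natCast_self]
  constructor <;> intro h <;> linear_combination -h

theorem add_one_cast_eq_iff {t i j : ℕ} (hi : i < t) (hj1 : 1 ≤ j) (hj : j < t) :
    (i : ZMod t) + 1 = (j : ZMod t) ↔ i = j - 1 := by
  have h := ZMod.natCast_eq_natCast_iff' (i + 1) j t
  rw [Nat.cast_succ, Nat.mod_eq_of_lt hj] at h
  rw [h]
  rcases Nat.lt_or_ge (i + 1) t with h1 | h1
  · rw [Nat.mod_eq_of_lt h1]
    omega
  · rw [show i + 1 = t by omega, Nat.mod_self]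
    omega

/-- The size of the `i`-th residue class of the beta-set. -/
def classSize (N ν j : ℕ) (k : ℤ) (i : ℕ) : ℤ :=
  N + k * (if i = j - 1 then 1 else 0) - k * (if i = j then 1 else 0) + if i < ν then 1 else 0

theorem gbgRank_eq_iff_classSize {n t N ν j : ℕ} (ht : t.Prime) (hν : ν < t) (hj1 : 1 ≤ j)
    (hj : j < t) (k : ℤ) {p : n.Partition} (hp : largestPart p ≤ t * N + ν) :
    gbgRank p t = (k : ℂ) * rootOmega t ^ j ↔
      ∀ r : Fin t, (#{b ∈ betaSet p (t * N + ν) | b % t = r} : ℤ) =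
        classSize N ν j k (reflectPerm hν r) := by
  have : NeZero t := ⟨ht.ne_zero⟩
  rw [gbgRank_eq_iff ht hp hj k, ← (reflectPerm hν).forall_congr_right]
  have key : ∀ i : Fin t,
      ((#{b ∈ betaSet p (t * N + ν) |
          ((t * N + ν : ℕ) : ZMod t) - 1 - ((b : ℕ) : ZMod t) = ((i : ℕ) : ZMod t)} : ℤ) =
        #{c ∈ range (t * N + ν) | ((c : ℕ) : ZMod t) = ((i : ℕ) : ZMod t)}
          + k * (if ((i : ℕ) : ZMod t) + 1 = j then 1 else 0)
          - k * (if ((i : ℕ) : ZMod t) = j then 1 else 0)) ↔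
      (#{b ∈ betaSet p (t * N + ν) | b % t = reflectPerm hν i} : ℤ) =
        classSize N ν j k (reflectPerm hν (reflectPerm hν i)) := by
    intro i
    have hcast : ((i : ℕ) : ZMod t) = j ↔ (i : ℕ) = j := by
      rw [ZMod.natCast_eq_natCast_iff', Nat.mod_eq_of_lt i.2, Nat.mod_eq_of_lt hj]
    have hfilter : {b ∈ betaSet p (t * N + ν) |
          ((t * N + ν : ℕ) : ZMod t) - 1 - ((b : ℕ) : ZMod t) = ((i : ℕ) : ZMod t)} =
        {b ∈ betaSet p (t * N + ν) | b % t = reflectPerm hν i} :=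
      filter_congr fun b _ => reflect_cast_eq_iff hν i.2 b
    rw [hfilter]
    simp only [add_one_cast_eq_iff i.2 hj1 hj, hcast, reflectPerm_reflectPerm,
      card_range_filter_cast_eq hν i.2, classSize]
    push_cast
    split_ifs <;> constructor <;> intro h <;> linarith
  simp_rw [← key]
  constructor
  · exact fun h i => h _
  · intro h a
    have := h ⟨a.val, ZMod.val_lt a⟩
    rwa [ZMod.natCast_zmod_val] at this

/-! ### The exponent of `q` -/

theorem sum_range_affine (n : ℕ) (A B : ℤ) :
    ∑ i ∈ range n, (A - 2 * i * B) = n * A - n * (n - 1) * B := by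
  induction n with
  | zero => simp
  | succ n ih => rw [sum_range_succ, ih]; push_cast; ring

theorem sum_classSize {t N ν j : ℕ} (hν : ν < t) (hj1 : 1 ≤ j) (hj : j < t) (k : ℤ) :
    ∑ i ∈ range t, classSize N ν j k i = (t * N + ν : ℕ) := by
  have h1 : {i ∈ range t | i < ν} = range ν := by
    ext i
    simp only [mem_filter, mem_range]
    omega
  have h2 : ∀ c < t, ∑ i ∈ range t, (if i = c then (1 : ℤ) else 0) = 1 := fun c hc => by
    rw [sum_ite_eq', if_pos (mem_range.2 hc)]
  simp only [classSize, sum_add_distrib, sum_sub_distrib, ← mul_sum, h2 j hj,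
    h2 (j - 1) (by omega)]
  rw [sum_boole, h1]
  simp

/-- The case `k = 0`: twice the sum of `{0, …, M - 1}`, the beta-set of the empty partition. -/
theorem two_mul_sum_weight_unperturbed {t N ν : ℕ} (hν : ν < t) :
    ∑ i ∈ range t, (2 * reflectResidue t ν i * ((N : ℤ) + if i < ν then 1 else 0) +
      t * ((N + if i < ν then 1 else 0) * ((N + if i < ν then 1 else 0) - 1))) =
      (t * N + ν : ℤ) * (t * N + ν - 1) := by
  obtain ⟨s, rfl⟩ := Nat.exists_eq_add_of_lt hν
  rw [add_assoc, sum_range_add]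
  have h1 : ∀ i ∈ range ν, (2 * (reflectResidue (ν + (s + 1)) ν i : ℤ) *
      ((N : ℤ) + if i < ν then 1 else 0) + (ν + (s + 1) : ℕ) *
        ((N + if i < ν then 1 else 0) * ((N + if i < ν then 1 else 0) - 1))) =
      (2 * (ν - 1) * (N + 1) + (ν + s + 1) * ((N + 1) * N)) - 2 * i * (N + 1) := by
    intro i hi
    rw [mem_range] at hi
    have : ((ν - 1 - i : ℕ) : ℤ) = ν - 1 - i := by omega
    simp only [reflectResidue, if_pos hi, this]
    push_cast
    ring
  have h2 : ∀ i ∈ range (s + 1), (2 * (reflectResidue (ν + (s + 1)) ν (ν + i) : ℤ) *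
      ((N : ℤ) + if ν + i < ν then 1 else 0) + (ν + (s + 1) : ℕ) *
        ((N + if ν + i < ν then 1 else 0) * ((N + if ν + i < ν then 1 else 0) - 1))) =
      (2 * (ν + s) * N + (ν + s + 1) * (N * (N - 1))) - 2 * i * N := by
    intro i hi
    rw [mem_range] at hi
    have : ((ν + (s + 1) + ν - 1 - (ν + i) : ℕ) : ℤ) = ν + s - i := by omega
    have hlt : ¬ ν + i < ν := by omega
    simp only [reflectResidue, if_neg hlt, this]
    push_cast
    ring
  rw [sum_congr rfl h1, sum_congr rfl h2, sum_range_affine, sum_range_affine]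
  push_cast
  ring

/-- Only the indices `j - 1` and `j` feel `k`. The change depends on `i` through the residue plus
`t` times the unperturbed size, which is affine in `i` with slope `-1` (`hu`), so the two linear
terms leave just `2 k`. -/
theorem two_mul_sum_weight {t N ν j : ℕ} (hν : ν < t) (hj1 : 1 ≤ j) (hj : j < t) (k : ℤ) :
    ∑ i ∈ range t, (2 * reflectResidue t ν i * classSize N ν j k i +
      t * (classSize N ν j k i * (classSize N ν j k i - 1))) =
      (t * N + ν : ℤ) * (t * N + ν - 1) + 2 * (t * k ^ 2 + k) := by
  have hu : ∀ i < t, (reflectResidue t ν i : ℤ) + t * ((N : ℤ) + if i < ν then 1 else 0) =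
      t * N + ν - 1 + t - i := by
    intro i hi
    unfold reflectResidue
    split_ifs with h
    · have : ((ν - 1 - i : ℕ) : ℤ) = ν - 1 - i := by omega
      rw [this]; ring
    · have : ((t + ν - 1 - i : ℕ) : ℤ) = t + ν - 1 - i := by omega
      rw [this]; ring
  have hterm : ∀ i ∈ range t, (2 * reflectResidue t ν i * classSize N ν j k i +
      t * (classSize N ν j k i * (classSize N ν j k i - 1))) =
      (2 * reflectResidue t ν i * ((N : ℤ) + if i < ν then 1 else 0) +
        t * ((N + if i < ν then 1 else 0) * ((N + if i < ν then 1 else 0) - 1))) +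
      ((if i = j - 1 then k * (2 * (t * N + ν - 1 + t - i) - t) + t * k ^ 2 else 0) +
        if i = j then -k * (2 * (t * N + ν - 1 + t - i) - t) + t * k ^ 2 else 0) := by
    intro i hi
    rw [← hu i (mem_range.1 hi), classSize]
    by_cases h1 : i = j - 1
    · have h2 : i ≠ j := by omega
      simp only [if_pos h1, if_neg h2]
      ring
    · by_cases h2 : i = j
      · simp only [if_neg h1, if_pos h2]
        ring
      · simp only [if_neg h1, if_neg h2]
        ring
  rw [sum_congr rfl hterm, sum_add_distrib, two_mul_sum_weight_unperturbed hν, sum_add_distrib,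
    sum_ite_eq', sum_ite_eq', if_pos (mem_range.2 (show j - 1 < t by omega)),
    if_pos (mem_range.2 hj)]
  push_cast [hj1]
  ring

theorem sum_weight {t N ν j : ℕ} (hν : ν < t) (hj1 : 1 ≤ j) (hj : j < t) (k : ℤ) (m : ℕ → ℕ)
    (hm : ∀ i < t, (m i : ℤ) = classSize N ν j k i) :
    ∑ i ∈ range t, (reflectResidue t ν i * m i + t * (m i).choose 2) =
      ((t : ℤ) * k ^ 2 + k).toNat + (t * N + ν).choose 2 := by
  have hchoose : ∀ x : ℕ, 2 * ((x.choose 2 : ℕ) : ℤ) = x * (x - 1) := by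
    intro x
    induction x with
    | zero => simp
    | succ x ih =>
      rw [Nat.choose_succ_succ' x 1, Nat.choose_one_right]
      push_cast
      linear_combination ih
  -- The bound `t k² + k ≥ k² + k ≥ 0` over `ℤ` makes `toNat` lossless.
  have hpos : 0 ≤ (t : ℤ) * k ^ 2 + k := by
    have : (1 : ℤ) ≤ t := by omega
    nlinarith [sq_nonneg k, sq_nonneg (2 * k + 1), Int.le_self_sq (-k)]
  have h := two_mul_sum_weight (N := N) hν hj1 hj k
  zify
  rw [Int.toNat_of_nonneg hpos]
  have h3 := hchoose (t * N + ν)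
  push_cast at h3 ⊢
  have h4 : 2 * ∑ i ∈ range t, ((reflectResidue t ν i : ℤ) * m i + t * ((m i).choose 2 : ℕ)) =
      ∑ i ∈ range t, (2 * reflectResidue t ν i * classSize N ν j k i +
        t * (classSize N ν j k i * (classSize N ν j k i - 1))) := by
    rw [mul_sum]
    refine sum_congr rfl fun i hi => ?_
    rw [← hm i (mem_range.1 hi)]
    linear_combination (t : ℤ) * hchoose (m i)
  linarith

/-! ### Assembling the theorem -/

/-- The generating function of the finite subsets of `ℕ` with prescribed residue class sizes,
up to a large power of `X`. -/
theorem coeff_sum_residue_classes {t K d : ℕ} (ht : 0 < t) (hd : d < t * K) (m : Fin t → ℕ) :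
    PowerSeries.coeff d (∑ B ∈ (range (t * K)).powerset with ∀ r : Fin t, #{b ∈ B | b % t = r} = m r,
        (PowerSeries.X : ℚ⟦X⟧) ^ (∑ b ∈ B, b)) =
      PowerSeries.coeff d (PowerSeries.X ^ (∑ r : Fin t, ((r : ℕ) * m r + t * (m r).choose 2)) *
        ∏ r : Fin t, (qPoch ((PowerSeries.X : ℚ⟦X⟧) ^ t) (PowerSeries.X ^ t) (m r))⁻¹) := by
  rw [sum_pow_residue_classes, ← sub_eq_zero, ← map_sub]
  refine PowerSeries.X_pow_dvd_iff.1 ?_ d hd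
  rw [← prod_pow_eq_pow_sum, ← prod_mul_distrib, pow_mul, ← Ideal.mem_span_singleton,
    ← Ideal.Quotient.eq, map_prod, map_prod]
  refine prod_congr rfl fun r _ => ?_
  rw [Ideal.Quotient.eq, Ideal.mem_span_singleton, pow_add, pow_mul _ t, mul_assoc, ← mul_sub]
  exact (pow_dvd_subsetGen_sub _ (by simp [ht.ne']) _ _).mul_left _

theorem theorem4p1 (t : ℕ) (ht : t.Prime) (hodd : Odd t) (N ν j : ℕ) (hν : ν ≤ t - 1)
    (hj1 : 1 ≤ j) (hjt : j ≤ t - 1) (k : ℤ) :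
    gbgGenFun (t * N + ν) t ((k : ℂ) * rootOmega t ^ j) =
      (PowerSeries.X : ℚ⟦X⟧) ^ ((t : ℤ) * k ^ 2 + k).toNat *
        ∏ i ∈ Finset.range t,
          qPochRecip ((PowerSeries.X : ℚ⟦X⟧) ^ t)
            ((N : ℤ) + k * (if i = j - 1 then 1 else 0) - k * (if i = j then 1 else 0)
              + ⌈((ν : ℚ) - (i : ℚ)) / (t : ℚ)⌉) := by
  have htpos := ht.pos
  have hν' : ν < t := by omega
  have hj : j < t := by omega
  have hprod : ∏ i ∈ Finset.range t, qPochRecip ((PowerSeries.X : ℚ⟦X⟧) ^ t)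
      ((N : ℤ) + k * (if i = j - 1 then 1 else 0) - k * (if i = j then 1 else 0)
        + ⌈((ν : ℚ) - (i : ℚ)) / (t : ℚ)⌉) =
      ∏ i ∈ range t, qPochRecip ((PowerSeries.X : ℚ⟦X⟧) ^ t) (classSize N ν j k i) :=
    prod_congr rfl fun i hi => by rw [ceil_sub_div_eq hν' (mem_range.1 hi), classSize]
  rw [hprod]
  set M := t * N + ν with hM
  by_cases hneg : ∃ i < t, classSize N ν j k i < 0
  · obtain ⟨i, hi, hlt⟩ := hneg
    rw [prod_eq_zero (mem_range.2 hi) (by rw [qPochRecip, if_pos hlt]), mul_zero]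
    ext n
    rw [gbgGenFun, PowerSeries.coeff_mk, map_zero, Nat.cast_eq_zero, card_eq_zero,
      filter_eq_empty_iff]
    rintro p - ⟨hp1, hp2⟩
    have := (gbgRank_eq_iff_classSize ht hν' hj1 hj k hp2).1 hp1 (reflectPerm hν' ⟨i, hi⟩)
    rw [reflectPerm_reflectPerm] at this
    simp only at this
    omega
  · push Not at hneg
    set m : ℕ → ℕ := fun i => (classSize N ν j k i).toNat with hmdef
    have hm : ∀ i < t, (m i : ℤ) = classSize N ν j k i := fun i hi =>
      Int.toNat_of_nonneg (hneg i hi)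
    have hsum : ∑ r : Fin t, ((r : ℕ) * m (reflectPerm hν' r) +
        t * (m (reflectPerm hν' r)).choose 2) = ((t : ℤ) * k ^ 2 + k).toNat + M.choose 2 := by
      rw [← sum_weight hν' hj1 hj k m hm, ← Equiv.sum_comp (reflectPerm hν'),
        ← Fin.sum_univ_eq_sum_range fun i => reflectResidue t ν i * m i + t * (m i).choose 2]
      refine sum_congr rfl fun i _ => ?_
      rw [coe_reflectPerm, reflectPerm_reflectPerm]
    have hsumm : ∑ r : Fin t, m (reflectPerm hν' r) = M := by
      rw [Equiv.sum_comp (reflectPerm hν') fun i => m i, Fin.sum_univ_eq_sum_range]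
      zify
      rw [hM, ← sum_classSize (N := N) hν' hj1 hj k]
      exact sum_congr rfl fun i hi => hm i (mem_range.1 hi)
    have hprod' : ∏ i ∈ range t, qPochRecip ((PowerSeries.X : ℚ⟦X⟧) ^ t) (classSize N ν j k i) =
        ∏ r : Fin t,
          (qPoch ((PowerSeries.X : ℚ⟦X⟧) ^ t) (PowerSeries.X ^ t) (m (reflectPerm hν' r)))⁻¹ := by
      rw [Equiv.prod_comp (reflectPerm hν') fun i : Fin t =>
        (qPoch ((PowerSeries.X : ℚ⟦X⟧) ^ t) (PowerSeries.X ^ t) (m i))⁻¹,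
        Fin.prod_univ_eq_prod_range fun i =>
          (qPoch ((PowerSeries.X : ℚ⟦X⟧) ^ t) (PowerSeries.X ^ t) (m i))⁻¹]
      exact prod_congr rfl fun i hi => by
        rw [qPochRecip, if_neg (not_lt.2 (hneg i (mem_range.1 hi)))]
    rw [hprod']
    ext n
    classical
    -- One bound serves twice: as the truncation order of the series and as the `W` of
    -- `card_partition_eq_card_finset`.
    have hd : n + M.choose 2 < t * (n + M.choose 2 + 1) :=
      (Nat.lt_succ_self _).trans_le (Nat.le_mul_of_pos_left _ htpos)
    have hcoeff := coeff_sum_residue_classes htpos hd fun r => m (reflectPerm hν' r)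
    -- Cancelling `X ^ (M.choose 2)` undoes the excess of the beta-set's sum over the partition's
    -- size.
    rw [hsum, pow_add, mul_assoc, mul_left_comm, PowerSeries.coeff_X_pow_mul, map_sum] at hcoeff
    rw [← hcoeff, gbgGenFun, PowerSeries.coeff_mk]
    simp_rw [PowerSeries.coeff_X_pow]
    rw [sum_boole, filter_filter, Nat.cast_inj]
    have hcard := card_partition_eq_card_finset n M _ hd
      fun B => ∀ r : Fin t, #{b ∈ B | b % t = r} = m (reflectPerm hν' r)
    have hleft : ∀ p : n.Partition,
        (gbgRank p t = (k : ℂ) * rootOmega t ^ j ∧ largestPart p ≤ M) ↔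
        ((∀ r : Fin t, #{b ∈ betaSet p M | b % t = r} = m (reflectPerm hν' r)) ∧
          largestPart p ≤ M) := by
      intro p
      refine and_congr_left fun hp => ?_
      rw [gbgRank_eq_iff_classSize ht hν' hj1 hj k hp]
      refine forall_congr' fun r => ?_
      rw [← hm _ (reflectPerm hν' r).2, Nat.cast_inj]
    have hright : ∀ B : Finset ℕ,
        (∀ r : Fin t, #{b ∈ B | b % t = r} = m (reflectPerm hν' r)) → B.card = M := by
      intro B hB
      rw [← hsumm, ← sum_congr rfl fun r _ => hB r,
        Fin.sum_univ_eq_sum_range fun r => #{b ∈ B | b % t = r}]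
      exact card_eq_sum_card_fiberwise fun b _ => mem_coe.2 (mem_range.2 (Nat.mod_lt b htpos))
    simp_rw [hleft]
    convert hcard using 2
    refine filter_congr fun B _ => ?_
    constructor
    · exact fun h => ⟨⟨hright B h.1, h.1⟩, h.2.symm⟩
    · exact fun h => ⟨h.1.2, h.2.symm⟩
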